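/- All graphs are finite, undirected and loopless, but may have multiple edges. A $k$-labeled multigraph is a multigraph in which $k$ different vertices are labeled $1,\dots,k$; let $\mathcal G_k$ be the set of isomorphism classes of $k$-labeled multigraphs, isomorphisms respecting the labels. The gluing product of two $k$-labeled multigraphs is obtained from their disjoint union by identifying vertices with the same label and keeping all edges with their multiplicities (for $k=0$ it is the disjoint union $\sqcup$). It makes $\mathcal G_k$ a commutative monoid, with identity the edgeless graph on the labeled vertices $1,\dots,k$. Let $\mathcal A_k$ be its monoid algebra over $\mathbb R$, and let $\mathcal A_k^0\subseteq\mathcal A_k$ be the subalgebra spanned by the graphs all of whose vertices are labeled. A quantum multigraph is an element of $\mathcal A_0$, i.e. a finite formal real linear combination of unlabeled multigraphs. Let $K_1$ be the one-vertex graph and $K_2^{j}$ the multigraph with two vertices and $j$ edges between them. A quantum multigraph $x$ and an element $y\in\mathcal A_k$ are said to coincide up to labels and isolated vertices if, after forgetting the labels in $y$, they become equal modulo adding and removing isolated vertices, i.e. modulo the linear span of all $G-(G\sqcup K_1)$ with $G\in\mathcal G_0$. A graph parameter is a map $t\colon\mathcal G_0\to\mathbb R$; forgetting labels, it extends to linear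 functionals $t\colon\mathcal A_k\to\mathbb R$ for all $k$. It is called isolate indifferent if $t(G\sqcup K_1)=t(G)$ for all $G\in\mathcal G_0$; flatly reflection positive if $t(x^2)\ge 0$ for all $k\ge 0$ and all $x\in\mathcal A_k^0$; and slowly growing if $\sum_{i=0}^\infty \frac1{i!}\,t(K_2^{2i})<\infty$. **Theorem.** Let $a$ be a quantum multigraph. Then $t(a)\ge 0$ for every isolate indifferent, flatly reflection positive and slowly growing graph parameter $t$ if and only if for every $\epsilon>0$ there exists $r\in\mathbb N$ such that $$a+\epsilon\sum_{i=0}^r\frac1{i!}\,K_2^{2i}$$ coincides, up to labels and isolated vertices, with a (finite) sum of squares of elements of $\mathcal A_r^0$. -/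

import Mathlib

noncomputable section

namespace QuantumMultigraph

/-- A finite loopless multigraph in which `k` different vertices are labeled from `1` to `k`.
The labeled vertices are the `Sum.inl i`, the remaining (unlabeled) vertices are
`Sum.inr 0, …, Sum.inr (n - 1)`; edges are unoriented and form a multiset. -/
structure LabeledMultigraph (k : ℕ) where
  /-- the number of unlabeled vertices -/
  n : ℕ
  /-- the edges, with multiplicity -/
  edges : Multiset (Sym2 (Fin k ⊕ Fin n))
  /-- there are no loops -/
  loopless : ∀ e ∈ edges, ¬ e.IsDiag

namespace LabeledMultigraph

/-- Label-preserving isomorphism: a bijection of the unlabeled vertices which, together with the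
identity on the labeled vertices, preserves all edge multiplicities. -/
def Iso {k : ℕ} (F G : LabeledMultigraph k) : Prop :=
  ∃ e : Fin F.n ≃ Fin G.n, F.edges.map (Sym2.map (Sum.map id e)) = G.edges

theorem Iso.refl {k : ℕ} (F : LabeledMultigraph k) : Iso F F :=
  ⟨Equiv.refl _, by simp⟩

theorem Iso.symm {k : ℕ} {F G : LabeledMultigraph k} (h : Iso F G) : Iso G F := by
  obtain ⟨e, he⟩ := h
  refine ⟨e.symm, ?_⟩
  rw [← he, Multiset.map_map, ← Sym2.map_comp, Sum.map_comp_map]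
  simp

theorem Iso.trans {k : ℕ} {F G H : LabeledMultigraph k} (h : Iso F G) (h' : Iso G H) :
    Iso F H := by
  obtain ⟨e, he⟩ := h
  obtain ⟨f, hf⟩ := h'
  refine ⟨e.trans f, ?_⟩
  rw [← hf, ← he, Multiset.map_map, ← Sym2.map_comp, Sum.map_comp_map]
  simp

instance setoid (k : ℕ) : Setoid (LabeledMultigraph k) :=
  ⟨Iso, Iso.refl, Iso.symm, Iso.trans⟩

/-- The transport of a multiset of edges along an injective map of vertices has no loops. -/
theorem loopless_map {α β : Type} {f : α → β} (hf : Function.Injective f)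
    {s : Multiset (Sym2 α)} (hs : ∀ e ∈ s, ¬ e.IsDiag) :
    ∀ e ∈ s.map (Sym2.map f), ¬ e.IsDiag := by
  intro e he
  obtain ⟨e', he', rfl⟩ := Multiset.mem_map.1 he
  rw [Sym2.isDiag_map hf]
  exact hs e' he'

theorem injective_left (k n m : ℕ) :
    Function.Injective (Sum.map id (Fin.castAdd m) : Fin k ⊕ Fin n → Fin k ⊕ Fin (n + m)) :=
  Function.injective_id.sumMap (Fin.castAdd_injective n m)

theorem injective_right (k n m : ℕ) :
    Function.Injective (Sum.map id (Fin.natAdd n) : Fin k ⊕ Fin m → Fin k ⊕ Fin (n + m)) :=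
  Function.injective_id.sumMap (Fin.natAdd_injective m n)

/-- The gluing product: the disjoint union in which vertices with the same label are identified
and all edges are kept, with their multiplicities added. -/
def glue {k : ℕ} (F G : LabeledMultigraph k) : LabeledMultigraph k where
  n := F.n + G.n
  edges := F.edges.map (Sym2.map (Sum.map id (Fin.castAdd G.n))) +
    G.edges.map (Sym2.map (Sum.map id (Fin.natAdd F.n)))
  loopless := by
    intro e he
    rcases Multiset.mem_add.1 he with h | h
    · exact loopless_map (injective_left k F.n G.n) F.loopless e h
    · exact loopless_map (injective_right k F.n G.n) G.loopless e h

/-- The multigraph with `k` labeled vertices, `n` unlabeled vertices and no edges. -/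
def edgeless (k n : ℕ) : LabeledMultigraph k where
  n := n
  edges := 0
  loopless := by simp

/-- Forgetting the labels: all `k + n` vertices become unlabeled. -/
def unlabel {k : ℕ} (F : LabeledMultigraph k) : LabeledMultigraph 0 where
  n := k + F.n
  edges := F.edges.map (Sym2.map (Sum.inr ∘ finSumFinEquiv))
  loopless := loopless_map (Sum.inr_injective.comp finSumFinEquiv.injective) F.loopless

/-- The unlabeled multigraph `K₂ʲ` with two vertices and `j` edges between them. -/
def doubleVertex (j : ℕ) : LabeledMultigraph 0 where
  n := 2
  edges := Multiset.replicate j s(Sum.inr 0, Sum.inr 1)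
  loopless := by
    intro e he
    rw [Multiset.eq_of_mem_replicate he]
    simp

theorem map_map_eq {α β γ : Type} {f : α → β} {g : β → γ} {h : α → γ} (H : ∀ x, g (f x) = h x)
    (s : Multiset (Sym2 α)) : (s.map (Sym2.map f)).map (Sym2.map g) = s.map (Sym2.map h) := by
  have : h = g ∘ f := funext fun x => (H x).symm
  rw [this, Multiset.map_map, Sym2.map_comp]

theorem map_map_comm {α β β' γ : Type} {f : α → β} {g : β → γ} {f' : α → β'} {g' : β' → γ}
    (H : ∀ x, g (f x) = g' (f' x)) (s : Multiset (Sym2 α)) :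
    (s.map (Sym2.map f)).map (Sym2.map g) = (s.map (Sym2.map f')).map (Sym2.map g') := by
  rw [map_map_eq H, map_map_eq fun _ => rfl]

/-- The bijection of `Fin (n + m)` that acts blockwise. -/
def blockEquiv {n n' m m' : ℕ} (e : Fin n ≃ Fin n') (f : Fin m ≃ Fin m') :
    Fin (n + m) ≃ Fin (n' + m') :=
  finSumFinEquiv.symm.trans ((Equiv.sumCongr e f).trans finSumFinEquiv)

theorem blockEquiv_castAdd {n n' m m' : ℕ} (e : Fin n ≃ Fin n') (f : Fin m ≃ Fin m') (x : Fin n) :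
    blockEquiv e f (Fin.castAdd m x) = Fin.castAdd m' (e x) := by
  simp [blockEquiv]

theorem blockEquiv_natAdd {n n' m m' : ℕ} (e : Fin n ≃ Fin n') (f : Fin m ≃ Fin m') (x : Fin m) :
    blockEquiv e f (Fin.natAdd n x) = Fin.natAdd n' (f x) := by
  simp [blockEquiv]

theorem glue_congr {k : ℕ} {F F' G G' : LabeledMultigraph k} (hF : Iso F F') (hG : Iso G G') :
    Iso (glue F G) (glue F' G') := by
  obtain ⟨e, he⟩ := hF
  obtain ⟨f, hf⟩ := hG
  refine ⟨blockEquiv e f, ?_⟩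
  refine (Multiset.map_add _ _ _).trans (congrArg₂ (· + ·)
    ((map_map_comm ?_ _).trans (congrArg (Multiset.map _) he))
    ((map_map_comm ?_ _).trans (congrArg (Multiset.map _) hf)))
  · rintro (x | x)
    · rfl
    · exact congrArg Sum.inr (blockEquiv_castAdd e f x)
  · rintro (x | x)
    · rfl
    · exact congrArg Sum.inr (blockEquiv_natAdd e f x)

theorem unlabel_congr {k : ℕ} {F G : LabeledMultigraph k} (h : Iso F G) :
    Iso (unlabel F) (unlabel G) := by
  obtain ⟨e, he⟩ := h
  refine ⟨blockEquiv (Equiv.refl (Fin k)) e, ?_⟩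
  refine (map_map_comm ?_ _).trans (congrArg (Multiset.map _) he)
  rintro (x | x)
  · exact congrArg Sum.inr (blockEquiv_castAdd (Equiv.refl (Fin k)) e x)
  · exact congrArg Sum.inr (blockEquiv_natAdd (Equiv.refl (Fin k)) e x)

theorem glue_comm {k : ℕ} (F G : LabeledMultigraph k) : Iso (glue F G) (glue G F) := by
  refine ⟨finAddFlip, ?_⟩
  refine (Multiset.map_add _ _ _).trans ((add_comm _ _).trans (congrArg₂ (· + ·) ?_ ?_))
  · apply map_map_eq
    rintro (x | x)
    · rfl
    · exact congrArg Sum.inr (finAddFlip_apply_natAdd x F.n)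
  · apply map_map_eq
    rintro (x | x)
    · rfl
    · exact congrArg Sum.inr (finAddFlip_apply_castAdd x G.n)

theorem glue_assoc {k : ℕ} (F G H : LabeledMultigraph k) :
    Iso (glue (glue F G) H) (glue F (glue G H)) := by
  refine ⟨finCongr (Nat.add_assoc _ _ _), ?_⟩
  unfold glue
  dsimp only
  simp only [Multiset.map_add]
  rw [add_assoc]
  congr 1
  · rw [map_map_eq fun _ => rfl]
    apply map_map_eq
    rintro (x | x) <;> simp [Fin.ext_iff]
  · congr 1
    · rw [map_map_eq fun _ => rfl]
      apply map_map_comm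
      rintro (x | x) <;> simp [Fin.ext_iff]
    · apply map_map_comm
      rintro (x | x) <;> simp [Fin.ext_iff, Nat.add_assoc]

theorem edgeless_glue {k : ℕ} (F : LabeledMultigraph k) : Iso (glue (edgeless k 0) F) F := by
  refine ⟨finCongr (Nat.zero_add _), ?_⟩
  refine (Multiset.map_add _ _ _).trans ((zero_add _).trans ((map_map_eq (h := id) ?_ _).trans ?_))
  · rintro (x | x)
    · rfl
    · exact congrArg Sum.inr (Fin.ext (Nat.zero_add _))
  · rw [Sym2.map_id, Multiset.map_id]

end LabeledMultigraph

open LabeledMultigraph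

/-- The set `𝒢ₖ` of isomorphism classes of `k`-labeled multigraphs. -/
def GraphClass (k : ℕ) : Type := Quotient (LabeledMultigraph.setoid k)

/-- The isomorphism class of a `k`-labeled multigraph. -/
def cls {k : ℕ} (F : LabeledMultigraph k) : GraphClass k := Quotient.mk _ F

namespace GraphClass

/-- `𝒢ₖ` is a commutative monoid under gluing; the identity has vertices `1, …, k` and no edges. -/
instance commMonoid (k : ℕ) : CommMonoid (GraphClass k) where
  mul := Quotient.map₂ glue fun _ _ hF _ _ hG => glue_congr hF hG
  one := cls (edgeless k 0)
  mul_assoc := by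
    rintro ⟨F⟩ ⟨G⟩ ⟨H⟩
    exact Quotient.sound (glue_assoc F G H)
  mul_comm := by
    rintro ⟨F⟩ ⟨G⟩
    exact Quotient.sound (glue_comm F G)
  one_mul := by
    rintro ⟨F⟩
    exact Quotient.sound (edgeless_glue F)
  mul_one := by
    rintro ⟨F⟩
    exact Quotient.sound ((glue_comm F (edgeless k 0)).trans (edgeless_glue F))

/-- The degree of a class: the number of unlabeled vertices. -/
def deg {k : ℕ} : GraphClass k → ℕ :=
  Quotient.lift (fun F => F.n) fun _ _ h => Fin.equiv_iff_eq.1 ⟨h.choose⟩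

/-- Forgetting the labels, on isomorphism classes. -/
def unlabel {k : ℕ} : GraphClass k → GraphClass 0 :=
  Quotient.map LabeledMultigraph.unlabel fun _ _ h => unlabel_congr h

/-- The one-vertex graph `K₁`. -/
def K₁ : GraphClass 0 := cls (edgeless 0 1)

/-- The graph `K₂ʲ` with two vertices and `j` edges between them. -/
def K₂ (j : ℕ) : GraphClass 0 := cls (doubleVertex j)

end GraphClass

/-- The graph algebra `𝒜ₖ`. The elements of `𝒜₀` are the quantum multigraphs. -/
abbrev GraphAlgebra (k : ℕ) : Type := MonoidAlgebra ℝ (GraphClass k)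

/-- A class of graphs, as a basis element of the graph algebra. -/
abbrev graph {k : ℕ} (G : GraphClass k) : GraphAlgebra k := MonoidAlgebra.single G 1

/-- The part `𝒜ₖᵈ` of degree `d` of the graph algebra. -/
def gradedPart (k d : ℕ) : Submodule ℝ (GraphAlgebra k) :=
  Submodule.span ℝ {x | ∃ G : GraphClass k, G.deg = d ∧ x = graph G}

/-- `x` is a sum of squares of elements of `𝒜ₖ⁰`. -/
def IsFlatSumOfSquares {k : ℕ} (x : GraphAlgebra k) : Prop :=
  ∃ (m : ℕ) (c : Fin m → GraphAlgebra k), (∀ i, c i ∈ gradedPart k 0) ∧ x = ∑ i, c i ^ 2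

/-- Forgetting the labels, as a linear map `𝒜ₖ → 𝒜₀`. -/
def forget (k : ℕ) : GraphAlgebra k →ₗ[ℝ] GraphAlgebra 0 :=
  MonoidAlgebra.mapDomainLinearMap ℝ ℝ GraphClass.unlabel

/-- The subspace of `𝒜₀` spanned by all `G - G ⊔ K₁`; dividing by it means that isolated
vertices may be added and removed. -/
def isolatedVertexRelations : Submodule ℝ (GraphAlgebra 0) :=
  Submodule.span ℝ {x | ∃ G : GraphClass 0, x = graph G - graph (G * GraphClass.K₁)}

/-- The quantum multigraph `x` and `y ∈ 𝒜ₖ` coincide up to labels and isolated vertices. -/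
def Coincide {k : ℕ} (x : GraphAlgebra 0) (y : GraphAlgebra k) : Prop :=
  x - forget k y ∈ isolatedVertexRelations

/-- A graph parameter. -/
abbrev GraphParameter : Type := GraphClass 0 → ℝ

namespace GraphParameter

/-- The linear extension of a graph parameter to `𝒜ₖ`, ignoring the labels. -/
def eval (t : GraphParameter) {k : ℕ} (x : GraphAlgebra k) : ℝ :=
  x.coeff.sum fun G c => c * t G.unlabel

/-- The value does not change when an isolated vertex is added. -/
def IsolateIndifferent (t : GraphParameter) : Prop :=
  ∀ G : GraphClass 0, t (G * GraphClass.K₁) = t G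

/-- `t (x²) ≥ 0` for all `k` and all `x ∈ 𝒜ₖ⁰`. -/
def FlatlyReflectionPositive (t : GraphParameter) : Prop :=
  ∀ k : ℕ, ∀ x ∈ gradedPart k 0, 0 ≤ t.eval (x ^ 2)

/-- The series `∑ t(K₂²ⁱ) / i!` converges. -/
def SlowlyGrowing (t : GraphParameter) : Prop :=
  Summable fun i : ℕ => (1 / (i.factorial : ℝ)) * t (GraphClass.K₂ (2 * i))

end GraphParameter

end QuantumMultigraph

end

/-!
Graphs with all vertices labeled are monomials in the edges, so `𝒜ₖ⁰` is a polynomial algebra, and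
a graph parameter that ignores isolated vertices is a linear functional on `IsolateFree`, the
quotient of `𝒜₀` by the isolated vertex relations. In that quotient a graph does not depend on the
vertex set in which its edges are placed (`bare_map`). Hence the cones `flatCone k` of images of
sums of squares increase with `k`, and flat reflection positivity says that the functional is
nonnegative on all of them.

If the certificates exist, then evaluating them at `t` gives `t(a) + ε S ≥ 0` for all `ε > 0`,
where `S` is the sum of the series of `t`; its terms are nonnegative since `K₂²ⁱ` is a square.

For the converse, a formal element is adjoined to `IsolateFree` that plays the role of the infinite
series `∑ K₂²ⁱ / i!`. The cone `seriesCone` in `IsolateFree × ℝ` is generated by the flat sums of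
squares `(x, 0)` and by the differences `(0, 1) - (expSum r, 0)` of the series and its truncations.
The inequality `2xy ≤ x² + y²`, used repeatedly, bounds every graph by even powers of single edges,
and these are bounded by the series (`neg_bare_nsmul_mem`). So the series is an order unit of the
cone (`exists_mem_seriesCone`). A certificate for `ε` is exactly a proof that `(a, ε)` lies in the
cone. If it does not, the extension theorem of M. Riesz (`exists_nonneg_of_orderUnit`) yields a
functional that is nonnegative on the cone, takes the value `1` at the series and is at most `-ε`
at `a`. It is flatly reflection positive and slowly growing, the partial sums of its series being
at most `1`.
-/

noncomputable section

namespace QuantumMultigraph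

open LabeledMultigraph

/-! ### Multigraphs given by a multiset of edges -/

theorem loopless_filter_map {α β : Type} [DecidableEq α] {f : α → β} (hf : Function.Injective f)
    (E : Multiset (Sym2 α)) :
    ∀ e ∈ (E.filter fun e => ¬ e.IsDiag).map (Sym2.map f), ¬ e.IsDiag :=
  loopless_map hf fun _ he => (Multiset.mem_filter.1 he).2

theorem filter_map_of_injective {α β : Type} [DecidableEq α] [DecidableEq β] {f : α → β}
    (hf : Function.Injective f) (E : Multiset (Sym2 α)) :
    (E.map (Sym2.map f)).filter (fun e => ¬ e.IsDiag) =
      (E.filter fun e => ¬ e.IsDiag).map (Sym2.map f) := by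
  rw [Multiset.filter_map]
  congr 1
  exact Multiset.filter_congr fun e _ => not_congr (Sym2.isDiag_map hf)

/-- The class of the unlabeled multigraph with vertex set `Fin n` and edge multiset `E`. Loops
in `E` are discarded, which makes the construction total. -/
def ofEdges (n : ℕ) (E : Multiset (Sym2 (Fin n))) : GraphClass 0 :=
  cls ⟨n, (E.filter fun e => ¬ e.IsDiag).map (Sym2.map Sum.inr),
    loopless_filter_map Sum.inr_injective E⟩

/-- The class of the fully labeled multigraph with vertex set `Fin k` and edge multiset `E`, loops
being discarded. -/
def flat (k : ℕ) (E : Multiset (Sym2 (Fin k))) : GraphClass k :=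
  cls ⟨0, (E.filter fun e => ¬ e.IsDiag).map (Sym2.map Sum.inl),
    loopless_filter_map Sum.inl_injective E⟩

/-- An isomorphism given on the underlying data, so that edge multisets can be rewritten without
touching the proofs of looplessness. -/
theorem cls_eq_cls {k n m : ℕ} {s : Multiset (Sym2 (Fin k ⊕ Fin n))}
    {t : Multiset (Sym2 (Fin k ⊕ Fin m))} {hs : ∀ e ∈ s, ¬ e.IsDiag} {ht : ∀ e ∈ t, ¬ e.IsDiag}
    (σ : Fin n ≃ Fin m) (h : s.map (Sym2.map (Sum.map id σ)) = t) :
    cls ⟨n, s, hs⟩ = cls ⟨m, t, ht⟩ :=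
  Quotient.sound ⟨σ, h⟩

theorem flat_add {k : ℕ} (E F : Multiset (Sym2 (Fin k))) :
    flat k (E + F) = flat k E * flat k F := by
  refine cls_eq_cls (finCongr rfl) ?_
  rw [Multiset.filter_add, Multiset.map_add, Multiset.map_add]
  refine congrArg₂ (· + ·) (map_map_comm (fun _ => rfl) _) ?_
  rw [map_map_eq fun _ => rfl, map_map_eq fun _ => rfl]
  rfl

theorem unlabel_flat {k : ℕ} (E : Multiset (Sym2 (Fin k))) :
    (flat k E).unlabel = ofEdges k E := by
  refine cls_eq_cls (finCongr (Nat.add_zero k)) ?_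
  rw [map_map_eq fun _ => rfl, map_map_eq fun _ => rfl]
  rfl

theorem ofEdges_map_equiv {n m : ℕ} (σ : Fin n ≃ Fin m) (E : Multiset (Sym2 (Fin n))) :
    ofEdges m (E.map (Sym2.map σ)) = ofEdges n E := by
  refine (cls_eq_cls σ ?_).symm
  rw [filter_map_of_injective σ.injective, map_map_eq fun _ => rfl, map_map_eq fun _ => rfl]
  rfl

theorem ofEdges_map_castSucc {n : ℕ} (E : Multiset (Sym2 (Fin n))) :
    ofEdges (n + 1) (E.map (Sym2.map Fin.castSucc)) = ofEdges n E * GraphClass.K₁ := by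
  refine cls_eq_cls (finCongr rfl) ?_
  rw [filter_map_of_injective (Fin.castSucc_injective n), map_map_eq fun _ => rfl,
    map_map_eq fun _ => rfl, map_map_eq fun _ => rfl]
  exact (add_zero _).symm

theorem exists_eq_ofEdges (G : GraphClass 0) : ∃ n E, G = ofEdges n E := by
  obtain ⟨F⟩ := G
  refine ⟨F.n, F.edges.map (Sym2.map (Sum.elim finZeroElim id)), cls_eq_cls (finCongr rfl) ?_⟩
  have hinj : Function.Injective (Sum.elim finZeroElim id : Fin 0 ⊕ Fin F.n → Fin F.n) := by
    rintro (x | x) (y | y) h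
    · exact x.elim0
    · exact x.elim0
    · exact y.elim0
    · exact congrArg Sum.inr h
  rw [filter_map_of_injective hinj, Multiset.filter_eq_self.2 F.loopless, map_map_eq fun _ => rfl]
  refine congrArg (fun f => F.edges.map (Sym2.map f)) (funext ?_)
  rintro (x | x)
  · exact x.elim0
  · rfl

theorem exists_eq_flat {k : ℕ} {G : GraphClass k} (hG : G.deg = 0) : ∃ E, G = flat k E := by
  obtain ⟨F⟩ := G
  obtain ⟨n, edges, loopless⟩ := F
  obtain rfl : n = 0 := hG
  refine ⟨edges.map (Sym2.map (Sum.elim id finZeroElim)), cls_eq_cls (finCongr rfl) ?_⟩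
  have hinj : Function.Injective (Sum.elim id finZeroElim : Fin k ⊕ Fin 0 → Fin k) := by
    rintro (x | x) (y | y) h
    · exact congrArg Sum.inl h
    · exact y.elim0
    · exact x.elim0
    · exact x.elim0
  rw [filter_map_of_injective hinj, Multiset.filter_eq_self.2 loopless, map_map_eq fun _ => rfl]
  refine congrArg (fun f => edges.map (Sym2.map f)) (funext ?_)
  rintro (x | x)
  · rfl
  · exact x.elim0

theorem K₂_eq_ofEdges (j : ℕ) :
    GraphClass.K₂ j = ofEdges 2 (Multiset.replicate j s(0, 1)) := by
  refine cls_eq_cls (finCongr rfl) ?_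
  rw [Multiset.filter_eq_self.2, Multiset.map_replicate, Multiset.map_replicate]
  · rfl
  · intro e he
    rw [Multiset.eq_of_mem_replicate he]
    simp

theorem unlabel_eq_self (G : GraphClass 0) : G.unlabel = G := by
  obtain ⟨F⟩ := G
  refine cls_eq_cls (finCongr (Nat.zero_add _)) ?_
  rw [map_map_eq (h := id), Sym2.map_id, Multiset.map_id]
  rintro (x | x)
  · exact x.elim0
  · exact congrArg Sum.inr (Fin.ext (Nat.zero_add _))

theorem gradedPart_zero_eq_span (k : ℕ) :
    gradedPart k 0 = Submodule.span ℝ (Set.range fun E => graph (flat k E)) := by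
  refine congrArg (Submodule.span ℝ) (Set.ext fun x => ⟨?_, ?_⟩)
  · rintro ⟨G, hG, rfl⟩
    obtain ⟨E, rfl⟩ := exists_eq_flat hG
    exact ⟨E, rfl⟩
  · rintro ⟨E, rfl⟩
    exact ⟨_, rfl, rfl⟩

theorem graph_flat_mem {k : ℕ} (E : Multiset (Sym2 (Fin k))) :
    graph (flat k E) ∈ gradedPart k 0 :=
  Submodule.subset_span ⟨_, rfl, rfl⟩

theorem graph_flat_mul {k : ℕ} (E F : Multiset (Sym2 (Fin k))) :
    graph (flat k E) * graph (flat k F) = graph (flat k (E + F)) := by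
  rw [flat_add, MonoidAlgebra.single_mul_single, one_mul]

/-! ### Quantum multigraphs up to isolated vertices -/
/-- Quantum multigraphs up to isolated vertices. -/
abbrev IsolateFree : Type := GraphAlgebra 0 ⧸ isolatedVertexRelations

/-- Forgetting labels and isolated vertices. -/
def reduce (k : ℕ) : GraphAlgebra k →ₗ[ℝ] IsolateFree :=
  isolatedVertexRelations.mkQ ∘ₗ forget k

/-- The class of an unlabeled multigraph, up to isolated vertices. -/
def bare (G : GraphClass 0) : IsolateFree := isolatedVertexRelations.mkQ (graph G)

theorem coincide_iff {k : ℕ} (x : GraphAlgebra 0) (y : GraphAlgebra k) :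
    Coincide x y ↔ isolatedVertexRelations.mkQ x = reduce k y :=
  (Submodule.Quotient.eq _).symm

theorem reduce_graph {k : ℕ} (G : GraphClass k) : reduce k (graph G) = bare G.unlabel := by
  simp [reduce, bare, forget]

theorem bare_mul_K₁ (G : GraphClass 0) : bare (G * GraphClass.K₁) = bare G :=
  ((Submodule.Quotient.eq isolatedVertexRelations).2 (Submodule.subset_span ⟨G, rfl⟩)).symm

theorem reduce_graph_flat {k : ℕ} (E : Multiset (Sym2 (Fin k))) :
    reduce k (graph (flat k E)) = bare (ofEdges k E) := by
  rw [reduce_graph, unlabel_flat]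

theorem bare_map_castAdd {n : ℕ} (E : Multiset (Sym2 (Fin n))) (m : ℕ) :
    bare (ofEdges (n + m) (E.map (Sym2.map (Fin.castAdd m)))) = bare (ofEdges n E) := by
  induction m with
  | zero =>
    rw [show (Fin.castAdd 0 : Fin n → Fin (n + 0)) = id from rfl, Sym2.map_id, Multiset.map_id]
    rfl
  | succ m ih =>
    rw [← ih, ← bare_mul_K₁ (ofEdges (n + m) _), ← ofEdges_map_castSucc, map_map_eq fun _ => rfl]
    rfl

/-- Up to isolated vertices, a multigraph does not change when its vertex set is embedded into a
larger one. -/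
theorem bare_map {n m : ℕ} {f : Fin n → Fin m} (hf : Function.Injective f)
    (E : Multiset (Sym2 (Fin n))) :
    bare (ofEdges m (E.map (Sym2.map f))) = bare (ofEdges n E) := by
  obtain ⟨d, rfl⟩ := Nat.exists_eq_add_of_le (by simpa using Fintype.card_le_of_injective f hf)
  obtain ⟨σ, hσ⟩ := Equiv.Perm.exists_extending_pair (Fin.castAdd d) f
    (Fin.castAdd_injective n d) hf
  rw [← bare_map_castAdd E d, ← ofEdges_map_equiv σ (E.map (Sym2.map (Fin.castAdd d))),
    map_map_eq hσ]

theorem bare_replicate {k : ℕ} {i j : Fin k} (hij : i ≠ j) (n : ℕ) :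
    bare (ofEdges k (Multiset.replicate n s(i, j))) = bare (GraphClass.K₂ n) := by
  have hf : Function.Injective ![i, j] := by
    intro x y h
    fin_cases x <;> fin_cases y <;> simp_all
  rw [K₂_eq_ofEdges, ← bare_map hf, Multiset.map_replicate]
  rfl

/-! ### Separation of a point from a cone with an order unit -/
/-- A point outside a cone with order unit `v` is weakly separated from the cone by a functional
normalized at `v`: no closedness of the cone is needed. -/
theorem exists_nonneg_of_orderUnit {E : Type*} [AddCommGroup E] [Module ℝ E] (C : PointedCone ℝ E)
    {v p : E} (hv : v ∈ C) (unit : ∀ y, ∃ c : ℝ, c • v + y ∈ C) (hp : p ∉ C) :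
    ∃ L : E →ₗ[ℝ] ℝ, (∀ x ∈ C, 0 ≤ L x) ∧ L v = 1 ∧ L p ≤ 0 := by
  -- `C'` is the cone generated by `C` and `-p`; on it the functional `c • v ↦ c` is extended.
  let C' : PointedCone ℝ E :=
    { carrier := {x | ∃ μ : ℝ, 0 ≤ μ ∧ x + μ • p ∈ C}
      zero_mem' := ⟨0, le_rfl, by simp⟩
      add_mem' := by
        rintro x y ⟨μ, hμ, hx⟩ ⟨ν, hν, hy⟩
        refine ⟨μ + ν, add_nonneg hμ hν, ?_⟩
        convert C.add_mem hx hy using 1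
        module
      smul_mem' := by
        rintro ⟨c, hc⟩ x ⟨μ, hμ, hx⟩
        refine ⟨c * μ, mul_nonneg hc hμ, ?_⟩
        convert C.smul_mem hc hx using 1
        change c • x + _ = _
        module }
  have le : ∀ x ∈ C, x ∈ C' := fun x hx => ⟨0, le_rfl, by simp [hx]⟩
  -- If `-v` were in `C'`, the order unit property would put `p` into `C`.
  have neg_v : -v ∉ C' := by
    rintro ⟨μ, hμ, h⟩
    apply hp
    rcases hμ.eq_or_lt with rfl | hμ
    · obtain ⟨c, hc⟩ := unit p
      rcases le_total 0 c with h0 | h0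
      · convert C.add_mem hc (C.smul_mem h0 h) using 1
        module
      · convert C.add_mem hc (C.smul_mem (neg_nonneg.2 h0) hv) using 1
        module
    · convert C.smul_mem (inv_nonneg.2 hμ.le) (C.add_mem h hv) using 1
      rw [show -v + μ • p + v = μ • p by module, inv_smul_smul₀ hμ.ne']
  have v_ne : v ≠ 0 := by
    rintro rfl
    exact neg_v (by simp)
  obtain ⟨L, hL, hC⟩ := riesz_extension C' (LinearPMap.mkSpanSingleton v (1 : ℝ) v_ne) (by
      rintro ⟨x, hx⟩ hxC
      obtain ⟨c, rfl⟩ := Submodule.mem_span_singleton.1 hx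
      rw [LinearPMap.mkSpanSingleton'_apply]
      by_contra! hc
      have hc : c < 0 := by simpa using hc
      apply neg_v
      convert C'.smul_mem (inv_nonneg.2 (neg_nonneg.2 hc.le)) hxC using 1
      rw [smul_smul, inv_neg, neg_mul, inv_mul_cancel₀ hc.ne, neg_one_smul]) (by
      intro y
      obtain ⟨c, hc⟩ := unit y
      exact ⟨⟨c • v, Submodule.smul_mem _ _ (Submodule.mem_span_singleton_self v)⟩, le _ hc⟩)
  refine ⟨L, fun x hx => hC x (le x hx), ?_, ?_⟩
  · rw [hL ⟨v, Submodule.mem_span_singleton_self v⟩]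
    exact LinearPMap.mkSpanSingleton_apply ℝ ℝ v_ne 1
  · have := hC (-p) ⟨1, zero_le_one, by simp⟩
    simpa using this

/-! ### The cones of flat sums of squares -/
/-- The cone generated by the squares of elements of `𝒜ₖ⁰`, up to labels and isolated vertices. -/
def flatCone (k : ℕ) : PointedCone ℝ IsolateFree :=
  PointedCone.hull ℝ {x | ∃ c ∈ gradedPart k 0, x = reduce k (c ^ 2)}

theorem reduce_sq_mem {k : ℕ} {c : GraphAlgebra k} (hc : c ∈ gradedPart k 0) :
    reduce k (c ^ 2) ∈ flatCone k :=
  PointedCone.subset_hull ⟨c, hc, rfl⟩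

theorem exists_isFlatSumOfSquares {k : ℕ} {x : IsolateFree} (hx : x ∈ flatCone k) :
    ∃ σ : GraphAlgebra k, IsFlatSumOfSquares σ ∧ x = reduce k σ := by
  induction hx using Submodule.span_induction with
  | mem x hx =>
    obtain ⟨c, hc, rfl⟩ := hx
    exact ⟨c ^ 2, ⟨1, fun _ => c, fun _ => hc, by simp⟩, rfl⟩
  | zero => exact ⟨0, ⟨0, Fin.elim0, fun i => i.elim0, by simp⟩, by simp⟩
  | add x y _ _ ihx ihy =>
    obtain ⟨_, ⟨m, c, hc, rfl⟩, rfl⟩ := ihx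
    obtain ⟨_, ⟨n, d, hd, rfl⟩, rfl⟩ := ihy
    refine ⟨_, ⟨m + n, Fin.append c d, fun i => ?_, rfl⟩, ?_⟩
    · induction i using Fin.addCases with
      | left i => simpa using hc i
      | right i => simpa using hd i
    · rw [Fin.sum_univ_add, map_add]
      simp
  | smul a x _ ih =>
    obtain ⟨_, ⟨m, c, hc, rfl⟩, rfl⟩ := ih
    refine ⟨_, ⟨m, fun i => √(a : ℝ) • c i, fun i => Submodule.smul_mem _ _ (hc i), rfl⟩, ?_⟩
    simp only [smul_pow, Real.sq_sqrt a.2, ← Finset.smul_sum, map_smul]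
    rfl

/-- Additional labeled vertices are isolated, hence invisible: a linear combination of graphs on
`Fin k` may be read on `Fin r`, and its square does not change. -/
theorem flatCone_mono : Monotone flatCone := by
  intro k r hkr
  refine Submodule.span_le.2 ?_
  rintro _ ⟨c, hc, rfl⟩
  rw [gradedPart_zero_eq_span] at hc
  obtain ⟨c, rfl⟩ := Finsupp.mem_span_range_iff_exists_finsupp.1 hc
  have sq : ∀ {m : ℕ} (g : Multiset (Sym2 (Fin k)) → Multiset (Sym2 (Fin m))),
      reduce m ((c.sum fun E a => a • graph (flat m (g E))) ^ 2) =
        c.sum fun E a => c.sum fun F b => (a * b) • bare (ofEdges m (g E + g F)) := by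
    intro m g
    simp only [Finsupp.sum, sq, Finset.sum_mul_sum, map_sum, smul_mul_smul_comm, graph_flat_mul,
      map_smul, reduce_graph_flat]
  have key := sq fun E => E.map (Sym2.map (Fin.castLE hkr))
  simp only [← Multiset.map_add, bare_map (Fin.castLE_injective hkr)] at key
  have := (sq fun E => E).trans key.symm
  rw [SetLike.mem_coe, this]
  exact reduce_sq_mem (Submodule.sum_mem _ fun E _ => Submodule.smul_mem _ _ (graph_flat_mem _))

/-- The square of `E + s F`, where a sum of edge multisets stands for a product of graphs. -/
theorem bare_sq_mem {k : ℕ} (E F : Multiset (Sym2 (Fin k))) (s : ℝ) :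
    bare (ofEdges k (2 • E)) + (2 * s) • bare (ofEdges k (E + F)) +
      s ^ 2 • bare (ofEdges k (2 • F)) ∈ flatCone k := by
  convert reduce_sq_mem (Submodule.add_mem _ (graph_flat_mem E)
    (Submodule.smul_mem _ s (graph_flat_mem F))) using 1
  rw [add_sq, mul_smul_comm, smul_pow, sq (graph (flat k E)), sq (graph (flat k F)), mul_assoc,
    graph_flat_mul, graph_flat_mul, graph_flat_mul, two_mul, ← two_smul ℝ]
  simp only [map_add, map_smul, reduce_graph_flat, two_smul, two_mul, add_smul, smul_add]

/-- `K₂²ⁱ` is the square of `i` parallel edges between two labeled vertices. -/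
theorem bare_K₂_mem {r : ℕ} (hr : 2 ≤ r) (i : ℕ) :
    bare (GraphClass.K₂ (2 * i)) ∈ flatCone r := by
  refine flatCone_mono hr ?_
  have h := bare_sq_mem (Multiset.replicate i s((0 : Fin 2), 1)) 0 0
  rw [← bare_replicate (zero_ne_one : (0 : Fin 2) ≠ 1), two_mul, Multiset.replicate_add,
    ← two_nsmul]
  simpa using h

/-! ### The truncated series as an order unit -/
/-- The truncated series `∑ K₂²ⁱ / i!`, up to isolated vertices. -/
def expSum (r : ℕ) : IsolateFree :=
  ∑ i ∈ Finset.range (r + 1), (1 / (i.factorial : ℝ)) • bare (GraphClass.K₂ (2 * i))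

theorem expSum_mem {s : ℕ} (hs : 2 ≤ s) : expSum s ∈ flatCone s :=
  Submodule.sum_mem _ fun i _ => (flatCone s).smul_mem (by positivity) (bare_K₂_mem hs i)

theorem expSum_sub_mem {r s : ℕ} (hrs : r ≤ s) (hs : 2 ≤ s) :
    expSum s - expSum r ∈ flatCone s := by
  rw [expSum, expSum, ← Finset.sum_sdiff (Finset.range_mono (Nat.succ_le_succ hrs)),
    add_sub_cancel_right]
  exact Submodule.sum_mem _ fun i _ => (flatCone s).smul_mem (by positivity) (bare_K₂_mem hs i)

theorem add_smul_expSum_mem {x : IsolateFree} {c : ℝ} (hc : 0 ≤ c) {r s : ℕ} (hrs : r ≤ s)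
    (hs : 2 ≤ s) (h : x + c • expSum r ∈ flatCone r) : x + c • expSum s ∈ flatCone s := by
  convert (flatCone s).add_mem (flatCone_mono hrs h)
    ((flatCone s).smul_mem hc (expSum_sub_mem hrs hs)) using 1
  module

/-- The pairs `(x, c)` for which `x + c * ∑ K₂²ⁱ / i!` is positive. The second coordinate plays the
role of the infinite series, which is not a quantum multigraph: by `expSum_sub_mem` the truncations
increase, so for `c ≥ 0` positivity can be tested on one of them. -/
def seriesCone : PointedCone ℝ (IsolateFree × ℝ) where
  carrier := {p | 0 ≤ p.2 ∧ ∃ r, p.1 + p.2 • expSum r ∈ flatCone r}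
  zero_mem' := ⟨le_rfl, 0, by simp⟩
  add_mem' := by
    rintro ⟨x, c⟩ ⟨y, d⟩ ⟨hc, r, hx⟩ ⟨hd, s, hy⟩
    refine ⟨add_nonneg hc hd, max (max r s) 2, ?_⟩
    convert (flatCone _).add_mem
      (add_smul_expSum_mem hc ((le_max_left r s).trans (le_max_left _ 2)) (le_max_right _ _) hx)
      (add_smul_expSum_mem hd ((le_max_right r s).trans (le_max_left _ 2)) (le_max_right _ _) hy)
      using 1
    dsimp only [Prod.mk_add_mk]
    module
  smul_mem' := by
    rintro ⟨a, ha⟩ ⟨x, c⟩ ⟨hc, r, hx⟩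
    refine ⟨mul_nonneg ha hc, r, ?_⟩
    convert (flatCone r).smul_mem ha hx using 1
    change a • x + (a * c) • expSum r = _
    module

theorem mk_zero_mem {x : IsolateFree} {k : ℕ} (hx : x ∈ flatCone k) : (x, (0 : ℝ)) ∈ seriesCone :=
  ⟨le_rfl, k, by simpa using hx⟩

theorem neg_expSum_mem (r : ℕ) : (-expSum r, (1 : ℝ)) ∈ seriesCone :=
  ⟨zero_le_one, r, by simp⟩

theorem neg_bare_K₂_mem (i : ℕ) :
    ∃ c : ℝ, (-bare (GraphClass.K₂ (2 * i)), c) ∈ seriesCone := by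
  refine ⟨i.factorial, Nat.cast_nonneg _, i + 2, ?_⟩
  have hi : (i.factorial : ℝ) ≠ 0 := Nat.cast_ne_zero.2 i.factorial_ne_zero
  have hmem : i ∈ Finset.range (i + 2 + 1) := by simp
  rw [expSum, ← Finset.add_sum_erase _ _ hmem, smul_add, smul_smul, mul_one_div_cancel hi,
    one_smul, neg_add_cancel_left]
  exact (flatCone _).smul_mem (Nat.cast_nonneg _) (Submodule.sum_mem _ fun j _ =>
    (flatCone _).smul_mem (by positivity) (bare_K₂_mem (Nat.le_add_left 2 i) j))

theorem bare_ofEdges_zero (k : ℕ) : bare (ofEdges k 0) = bare (GraphClass.K₂ 0) := by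
  rw [K₂_eq_ofEdges]
  exact (bare_map (Function.injective_of_subsingleton (finZeroElim : Fin 0 → Fin k)) 0).trans
    (bare_map (Function.injective_of_subsingleton (finZeroElim : Fin 0 → Fin 2)) 0).symm

theorem neg_bare_replicate_mem {k : ℕ} (e : Sym2 (Fin k)) (n : ℕ) :
    ∃ c : ℝ, (-bare (ofEdges k (Multiset.replicate (2 * n) e)), c) ∈ seriesCone := by
  induction e using Sym2.ind with
  | _ i j =>
  by_cases hij : i = j
  · have : ofEdges k (Multiset.replicate (2 * n) s(i, j)) = ofEdges k 0 := by
      refine cls_eq_cls (Equiv.refl _) ?_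
      rw [Multiset.filter_eq_nil.2 fun e he => by
        simp [Multiset.eq_of_mem_replicate he, hij]]
      simp
    rw [this, bare_ofEdges_zero]
    exact neg_bare_K₂_mem 0
  · rw [bare_replicate hij]
    exact neg_bare_K₂_mem n

/-- Even powers of a graph are bounded by the series. With `x` the first edge and `y` the rest,
`2 x²ⁿ y²ⁿ ≤ x⁴ⁿ + y⁴ⁿ`, and the induction applies to `y` with the exponent doubled. -/
theorem neg_bare_nsmul_mem {k : ℕ} (E : Multiset (Sym2 (Fin k))) (n : ℕ) :
    ∃ c : ℝ, (-bare (ofEdges k ((2 * n) • E)), c) ∈ seriesCone := by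
  induction E using Multiset.induction_on generalizing n with
  | empty =>
    rw [smul_zero, bare_ofEdges_zero]
    exact neg_bare_K₂_mem 0
  | cons e E ih =>
    obtain ⟨c, hc⟩ := neg_bare_replicate_mem e (2 * n)
    obtain ⟨d, hd⟩ := ih (2 * n)
    have h := mk_zero_mem (bare_sq_mem (Multiset.replicate (2 * n) e) ((2 * n) • E) (-1))
    have h' := seriesCone.smul_mem (by norm_num : (0 : ℝ) ≤ 1 / 2)
      (seriesCone.add_mem h (seriesCone.add_mem hc hd))
    refine ⟨1 / 2 * (0 + (c + d)), ?_⟩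
    convert h' using 1
    rw [Prod.mk_add_mk, Prod.mk_add_mk, Prod.smul_mk, smul_eq_mul]
    congr 1
    rw [smul_smul, two_nsmul (Multiset.replicate _ _), ← Multiset.replicate_add, ← two_mul,
      ← Multiset.singleton_add e E, smul_add (2 * n), Multiset.nsmul_singleton]
    module

/-- Every graph is bounded from both sides by the series, as `± 2 x ≤ x² + 1`. -/
theorem bare_mem_of_sign (G : GraphClass 0) (s : ℝ) (hs : s ^ 2 = 1) :
    ∃ c : ℝ, (s • bare G, c) ∈ seriesCone := by
  obtain ⟨k, E, rfl⟩ := exists_eq_ofEdges G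
  obtain ⟨c, hc⟩ := neg_bare_nsmul_mem E 1
  obtain ⟨d, hd⟩ := neg_bare_nsmul_mem (0 : Multiset (Sym2 (Fin k))) 1
  have h := mk_zero_mem (bare_sq_mem E 0 s)
  have h' := seriesCone.smul_mem (by norm_num : (0 : ℝ) ≤ 1 / 2)
    (seriesCone.add_mem h (seriesCone.add_mem hc hd))
  refine ⟨1 / 2 * (0 + (c + d)), ?_⟩
  convert h' using 1
  rw [Prod.mk_add_mk, Prod.mk_add_mk, Prod.smul_mk, smul_eq_mul, hs, mul_one, add_zero E]
  congr 1
  module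

/-- The pair `(0, 1)` is an order unit for `seriesCone`. -/
theorem exists_mem_seriesCone (x : IsolateFree) : ∃ c : ℝ, (x, c) ∈ seriesCone := by
  obtain ⟨x, rfl⟩ := isolatedVertexRelations.mkQ_surjective x
  induction x using MonoidAlgebra.induction_linear with
  | zero => exact ⟨0, by rw [map_zero]; exact seriesCone.zero_mem⟩
  | add x y hx hy =>
    obtain ⟨c, hc⟩ := hx
    obtain ⟨d, hd⟩ := hy
    exact ⟨c + d, by rw [map_add]; exact seriesCone.add_mem hc hd⟩
  | single G a =>
    have hG : isolatedVertexRelations.mkQ (MonoidAlgebra.single G a) = a • bare G := by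
      rw [bare, ← map_smul, MonoidAlgebra.smul_single, smul_eq_mul, mul_one]
    rw [hG]
    rcases le_total 0 a with ha | ha
    · obtain ⟨c, hc⟩ := bare_mem_of_sign G 1 (by norm_num)
      exact ⟨a * c, by simpa using seriesCone.smul_mem ha hc⟩
    · obtain ⟨c, hc⟩ := bare_mem_of_sign G (-1) (by norm_num)
      exact ⟨-a * c, by simpa using seriesCone.smul_mem (neg_nonneg.2 ha) hc⟩

/-! ### Graph parameters as linear functionals -/
theorem eval_eq_of_linear (t : GraphParameter) (f : IsolateFree →ₗ[ℝ] ℝ)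
    (hf : ∀ G, f (bare G) = t G) {k : ℕ} (x : GraphAlgebra k) : t.eval x = f (reduce k x) := by
  have h : t.eval x = Finsupp.linearCombination ℝ (fun G : GraphClass k => t G.unlabel)
      (MonoidAlgebra.coeffLinearEquiv ℝ x) := rfl
  rw [h]
  induction x using MonoidAlgebra.induction_linear with
  | zero => simp
  | add x y hx hy => rw [map_add, map_add, map_add, map_add, hx rfl, hy rfl]
  | single G a =>
    have hG : MonoidAlgebra.single G a = a • graph G := by
      rw [MonoidAlgebra.smul_single, smul_eq_mul, mul_one]
    rw [hG, map_smul, map_smul, map_smul, map_smul, reduce_graph, hf]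
    simp [MonoidAlgebra.coeffLinearEquiv]

theorem exists_linear_of_isolateIndifferent {t : GraphParameter} (ht : t.IsolateIndifferent) :
    ∃ f : IsolateFree →ₗ[ℝ] ℝ, ∀ G, f (bare G) = t G := by
  let T : GraphAlgebra 0 →ₗ[ℝ] ℝ :=
    Finsupp.linearCombination ℝ t ∘ₗ (MonoidAlgebra.coeffLinearEquiv ℝ).toLinearMap
  have hT : ∀ G, T (graph G) = t G := fun G => by simp [T, MonoidAlgebra.coeffLinearEquiv]
  refine ⟨isolatedVertexRelations.liftQ T ?_, fun G => ?_⟩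
  · refine Submodule.span_le.2 ?_
    rintro _ ⟨G, rfl⟩
    simp [hT, ht G]
  · exact (isolatedVertexRelations.liftQ_apply T _).trans (hT G)

theorem reduce_zero (a : GraphAlgebra 0) : reduce 0 a = isolatedVertexRelations.mkQ a := by
  induction a using MonoidAlgebra.induction_linear with
  | zero => simp
  | add x y hx hy => rw [map_add, map_add, hx, hy]
  | single G a => simp [reduce, forget, unlabel_eq_self]

theorem mkQ_add_series (a : GraphAlgebra 0) (ε : ℝ) (r : ℕ) :
    isolatedVertexRelations.mkQ (a + ε • ∑ i ∈ Finset.range (r + 1),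
      (1 / (i.factorial : ℝ)) • graph (GraphClass.K₂ (2 * i))) =
      isolatedVertexRelations.mkQ a + ε • expSum r := by
  simp only [map_add, map_smul, map_sum, expSum, bare]

theorem nonneg_of_mem_flatCone {t : GraphParameter} (ht : t.FlatlyReflectionPositive)
    {f : IsolateFree →ₗ[ℝ] ℝ} (hf : ∀ G, f (bare G) = t G) {k : ℕ} {x : IsolateFree}
    (hx : x ∈ flatCone k) : 0 ≤ f x := by
  have h : flatCone k ≤ PointedCone.comap f (PointedCone.positive ℝ ℝ) := by
    refine Submodule.span_le.2 ?_
    rintro _ ⟨c, hc, rfl⟩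
    have := ht k c hc
    rw [eval_eq_of_linear t f hf] at this
    exact this
  exact h hx

end QuantumMultigraph

/-! ### The Positivstellensatz -/

open QuantumMultigraph in
theorem theorem3p5 (a : GraphAlgebra 0) :
    (∀ t : GraphParameter, t.IsolateIndifferent → t.FlatlyReflectionPositive → t.SlowlyGrowing →
        0 ≤ t.eval a) ↔
      ∀ ε : ℝ, 0 < ε → ∃ r : ℕ, ∃ σ : GraphAlgebra r, IsFlatSumOfSquares σ ∧
        Coincide
          (a + ε • ∑ i ∈ Finset.range (r + 1),
            (1 / (i.factorial : ℝ)) • graph (GraphClass.K₂ (2 * i))) σ := by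
  constructor
  · intro h ε hε
    by_contra hcon
    -- A failure for `ε` means that `(a, ε)` can be separated from the cone.
    have ha : (isolatedVertexRelations.mkQ a, ε) ∉ seriesCone := by
      rintro ⟨-, r, hr⟩
      obtain ⟨σ, hσ, hx⟩ := exists_isFlatSumOfSquares hr
      exact hcon ⟨r, σ, hσ, (coincide_iff _ _).2 ((mkQ_add_series a ε r).trans hx)⟩
    obtain ⟨L, hL, hL1, hLa⟩ := exists_nonneg_of_orderUnit seriesCone (v := (0, 1))
      ⟨zero_le_one, 2, by simpa using expSum_mem le_rfl⟩ (by
        rintro ⟨x, d⟩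
        obtain ⟨c, hc⟩ := exists_mem_seriesCone x
        refine ⟨c - d, ?_⟩
        convert hc using 1
        simp) ha
    let f : IsolateFree →ₗ[ℝ] ℝ := L ∘ₗ LinearMap.inl ℝ IsolateFree ℝ
    have hf : ∀ x c, L (x, c) = f x + c := fun x c => by
      have : (x, c) = (x, (0 : ℝ)) + c • ((0 : IsolateFree), (1 : ℝ)) := by simp
      rw [this, map_add, map_smul, hL1, smul_eq_mul, mul_one]
      rfl
    have pos : ∀ {k} {x : IsolateFree}, x ∈ flatCone k → 0 ≤ f x := fun hx =>
      hL _ (mk_zero_mem hx)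
    -- The restriction `f` of the functional to the first coordinate is the graph parameter sought;
    -- positivity at `(-expSum n, 1)` bounds the partial sums of its series by `1`.
    have := h (fun G => f (bare G)) (fun G => by simp only [bare_mul_K₁]) (fun k x hx => by
        rw [eval_eq_of_linear _ f fun _ => rfl]
        exact pos (reduce_sq_mem hx)) (by
        refine summable_of_sum_range_le (c := 1)
          (fun i => mul_nonneg (by positivity) (pos (bare_K₂_mem le_rfl i))) fun n => ?_
        have hn := hL _ (neg_expSum_mem n)
        rw [hf, map_neg, expSum, map_sum, Finset.sum_range_succ] at hn
        simp only [map_smul, smul_eq_mul] at hn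
        have := mul_nonneg (by positivity : 0 ≤ 1 / (n.factorial : ℝ)) (pos (bare_K₂_mem le_rfl n))
        linarith)
    rw [eval_eq_of_linear _ f fun _ => rfl, reduce_zero] at this
    rw [hf] at hLa
    linarith
  · intro h t hiso hpos hslow
    obtain ⟨f, hf⟩ := exists_linear_of_isolateIndifferent hiso
    rw [eval_eq_of_linear t f hf, reduce_zero]
    set S := ∑' i : ℕ, (1 / (i.factorial : ℝ)) * t (GraphClass.K₂ (2 * i))
    have hterm : ∀ i : ℕ, 0 ≤ (1 / (i.factorial : ℝ)) * t (GraphClass.K₂ (2 * i)) := fun i =>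
      mul_nonneg (by positivity) (hf _ ▸ nonneg_of_mem_flatCone hpos hf (bare_K₂_mem le_rfl i))
    have hS : 0 ≤ S := tsum_nonneg hterm
    have hbound : ∀ r, f (expSum r) ≤ S := fun r => by
      rw [expSum, map_sum]
      simp only [map_smul, smul_eq_mul, hf]
      exact hslow.sum_le_tsum _ fun i _ => hterm i
    refine le_of_forall_pos_le_add fun δ hδ => ?_
    have hε : 0 < δ / (S + 1) := by positivity
    obtain ⟨r, _, ⟨m, c, hc, rfl⟩, hσ⟩ := h _ hε
    rw [coincide_iff, mkQ_add_series, map_sum] at hσ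
    have hsq := nonneg_of_mem_flatCone hpos hf
      (Submodule.sum_mem (flatCone r) fun i (_ : i ∈ Finset.univ) => reduce_sq_mem (hc i))
    rw [← hσ, map_add, map_smul, smul_eq_mul] at hsq
    have hle : δ / (S + 1) * f (expSum r) ≤ δ :=
      calc δ / (S + 1) * f (expSum r) ≤ δ / (S + 1) * (S + 1) :=
            mul_le_mul_of_nonneg_left ((hbound r).trans (by linarith)) hε.le
        _ = δ := div_mul_cancel₀ δ (by positivity)
    linarith

end
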